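/- Let $\mathcal M$ be an undiscounted Markov decision process, known up to its reward distribution, with finite state space $\mathcal S$, finite nonempty sets $\mathcal A_s$ of actions admissible at $s\in\mathcal S$, transition probabilities $p^S(s'\mid s,a)$, and a set $\mathcal S^g\subseteq\mathcal S$ of goal states that are absorbing: $p^S(s\mid s,a)=1$ for $s\in\mathcal S^g$, $a\in\mathcal A_s$. A reward distribution $p^R$ assigns to every pair $(s,a)$ with $a\in\mathcal A_s$ a probability law on $\mathbb R$ with finite mean $\mathbb E[R(s,a)]$, which is the point mass at $0$ if $s\in\mathcal S^g$. Let $\Pi$ be the set of stationary (randomised) policies $\pi$, where $\pi(\cdot\mid s)$ is a probability distribution on $\mathcal A_s$. For $\pi\in\Pi$ put $$V^\pi(s)=\lim_{\tau\to\infty}\mathbb E^\pi\Big[\sum_{t=0}^{\tau}R_t\,\Big|\,S_0=s\Big],\qquad Q^\pi(s,a)=\lim_{\tau\to\infty}\mathbb E^\pi\Big[\sum_{t=0}^{\tau}R_t\,\Big|\,S_0=s,A_0=a\Big],$$ and let $Q^*(s,a)=\sup_{\pi\in\Pi}Q^\pi(s,a)$ be the optimal action-value function. (When all expected rewards are nonpositive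 the limits defining $V^\pi$ and $Q^\pi$ exist in $[-\infty,0]$; in general read $\liminf$ in the definition of $Q^\pi$.) A policy $\pi$ is proper if $\mathbb P^\pi(S_t\notin\mathcal S^g\mid S_0=s)\to0$ as $t\to\infty$ for every $s\in\mathcal S$, and improper otherwise. Say that $\mathcal M$ paired with $p^R$ satisfies condition (P) if some stationary deterministic policy is proper and, for every improper stationary deterministic policy $\pi$, there is $s\in\mathcal S$ with $V^\pi(s)=-\infty$. Suppose that $\mathcal M$ satisfies (P) when paired with at least one reward distribution. Let $c<0$ and let $\mathcal Q^{\mathcal M}$ be the set of all real-valued functions $Q$ on $\{(s,a):s\in\mathcal S,\,a\in\mathcal A_s\}$ such that $$Q(s,a)-\sum_{s'\in\mathcal S}\max_{a'\in\mathcal A_{s'}}Q(s',a')\,p^S(s'\mid s,a)<c\quad\text{for all }s\in\mathcal S\setminus\mathcal S^g,\ a\in\mathcal A_s,$$ and $Q(s,a)=0$ for all $s\in\mathcal S^g$, $a\in\mathcal A_s$. Then: 1. For every $Q\in\mathcal Q^{\mathcal M}$ there is a reward distribution $p^R$ with $\mathbb E[R(s,a)]<c$ for all $s\in\mathcal S\setminus\mathcal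 S^g$, $a\in\mathcal A_s$, such that $\mathcal M$ paired with $p^R$ satisfies (P) and has $Q$ as its optimal action-value function. 2. Conversely, for every reward distribution $p^R$ such that $\mathbb E[R(s,a)]<c$ for all $s\in\mathcal S\setminus\mathcal S^g$, $a\in\mathcal A_s$, and such that $\mathcal M$ paired with $p^R$ satisfies (P), the optimal action-value function $Q^*$ is real-valued and belongs to $\mathcal Q^{\mathcal M}$. -/

import Mathlib

open MeasureTheory Filter Topology

noncomputable section

/-- A finite goal-directed (undiscounted, episodic) Markov decision process, known up to its reward
distribution. `S` is the state space and `A s` is the set of actions that are admissible at `s`, so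
that `(s : S) × A s` is the set of admissible state-action pairs. -/
structure GoalMDP (S : Type*) (A : S → Type*) where
  /-- the transition distribution `p(· | s, a)` -/
  trans : (s : S) → A s → PMF S
  /-- the initial state distribution -/
  init : PMF S
  /-- the set of goal states -/
  goal : Set S
  /-- goal states are absorbing -/
  absorbing : ∀ s ∈ goal, ∀ a : A s, trans s a = PMF.pure s

namespace GoalMDP

variable {S : Type*} {A : S → Type*}

/-- A reward distribution that can be paired with `M`: a probability law with finite mean on `ℝ` for
every admissible state-action pair, the reward being `0` almost surely at goal states. -/
structure RewardDist (M : GoalMDP S A) where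
  law : (s : S) → A s → Measure ℝ
  isProb : ∀ s a, IsProbabilityMeasure (law s a)
  integrable : ∀ s a, Integrable (fun r : ℝ => r) (law s a)
  goal_zero : ∀ s ∈ M.goal, ∀ a : A s, law s a = Measure.dirac 0

/-- The expected reward `E[R(s, a)]`. -/
def RewardDist.mean {M : GoalMDP S A} (R : M.RewardDist) (s : S) (a : A s) : ℝ :=
  ∫ r, r ∂(R.law s a)

/-- Stationary randomised policies. -/
abbrev Policy (A : S → Type*) := (s : S) → PMF (A s)

/-- Stationary deterministic policies. -/
abbrev DetPolicy (A : S → Type*) := (s : S) → A s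

/-- A deterministic policy seen as a policy (a Dirac mass at every state). -/
def DetPolicy.toPolicy (μ : DetPolicy A) : Policy A := fun s => PMF.pure (μ s)

/-- The law of the state-action pair `(s, a)` where `s` is given and `a ∼ π(· | s)`. -/
def pairAt (π : Policy A) (s : S) : PMF ((s : S) × A s) :=
  (π s).map (Sigma.mk s)

/-- The law of `(S_t, A_t)` when `(S_0, A_0) ∼ ν`, `S_{t+1} ∼ p(· | S_t, A_t)` and
`A_{t+1} ∼ π(· | S_{t+1})`. -/
def pairLaw (M : GoalMDP S A) (π : Policy A) (ν : PMF ((s : S) × A s)) :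
    ℕ → PMF ((s : S) × A s)
  | 0 => ν
  | t + 1 => (pairLaw M π ν t).bind fun x => (M.trans x.1 x.2).bind (pairAt π)

/-- The policy `π` is proper: `P^π(S_t ∉ goal | S_0 = s) → 0` for every state `s`. -/
def IsProper (M : GoalMDP S A) (π : Policy A) : Prop :=
  ∀ s : S, Tendsto
    (fun t : ℕ => (M.pairLaw π (pairAt π s) t).toOuterMeasure {x | x.1 ∉ M.goal}) atTop (𝓝 0)

/-- A reward distribution satisfies `E[R(s, a)] < c` at all non-goal pairs. -/
def RewardDist.NonGoalBelow {M : GoalMDP S A} (R : M.RewardDist) (c : ℝ) : Prop :=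
  ∀ s, s ∉ M.goal → ∀ a : A s, R.mean s a < c

variable [Fintype S] [∀ s, Fintype (A s)]

/-- `E^π[R_0 + ⋯ + R_τ]` when `(S_0, A_0) ∼ ν`, where `R_t` has conditional law
`R.law S_t A_t` given `(S_t, A_t)`; that is,
`∑_{t ≤ τ} ∑_{(s, a)} P^π(S_t = s, A_t = a) E[R(s, a)]`. -/
def expReturn (M : GoalMDP S A) (R : M.RewardDist) (π : Policy A) (ν : PMF ((s : S) × A s))
    (τ : ℕ) : ℝ :=
  ∑ t ∈ Finset.range (τ + 1), ∑ x : (s : S) × A s, (M.pairLaw π ν t x).toReal * R.mean x.1 x.2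

/-- The condition on `M` paired with a reward distribution: some stationary deterministic policy is
proper, and for each improper stationary deterministic policy there is a state `s` from which
`V^π(s) = lim_{τ → ∞} E^π[R_0 + ⋯ + R_τ | S_0 = s] = -∞`. -/
def ProperCondition (M : GoalMDP S A) (R : M.RewardDist) : Prop :=
  (∃ μ : DetPolicy A, M.IsProper μ.toPolicy) ∧
  ∀ μ : DetPolicy A, ¬ M.IsProper μ.toPolicy →
    ∃ s : S, Tendsto (fun τ : ℕ => M.expReturn R μ.toPolicy (pairAt μ.toPolicy s) τ) atTop atBot

/-- The action-value function `Q^π(s, a) = lim_{τ → ∞} E^π[R_0 + ⋯ + R_τ | S_0 = s, A_0 = a]`, with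
values in `[-∞, ∞]`. The lower limit is the limit whenever the latter exists, for example when all
expected rewards are nonpositive (the expected partial returns then decrease in `τ`). -/
def actionValue (M : GoalMDP S A) (R : M.RewardDist) (π : Policy A) (s : S) (a : A s) : EReal :=
  liminf (fun τ : ℕ => ((M.expReturn R π (PMF.pure ⟨s, a⟩) τ : ℝ) : EReal)) atTop

/-- The optimal action-value function `Q^*(s, a) = sup_π Q^π(s, a)`. -/
def optActionValue (M : GoalMDP S A) (R : M.RewardDist) (s : S) (a : A s) : EReal :=
  ⨆ π : Policy A, M.actionValue R π s a

variable [∀ s, Nonempty (A s)]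

/-- The Bellman residual `Q(s, a) - ∑_{s'} max_{a'} Q(s', a') p(s' | s, a)`. -/
def bellmanResidual (M : GoalMDP S A) (Q : (s : S) → A s → ℝ) (s : S) (a : A s) : ℝ :=
  Q s a - ∑ s' : S, Finset.univ.sup' Finset.univ_nonempty (Q s') * (M.trans s a s').toReal

/-- The set `Q^M` of real functions on the admissible pairs whose Bellman residual is below `c` at
non-goal pairs and that vanish at goal pairs. -/
def residualSet (M : GoalMDP S A) (c : ℝ) : Set ((s : S) → A s → ℝ) :=
  {Q | (∀ s, s ∉ M.goal → ∀ a : A s, M.bellmanResidual Q s a < c) ∧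
    ∀ s ∈ M.goal, ∀ a : A s, Q s a = 0}

end GoalMDP

end

open MeasureTheory Filter Topology

noncomputable section

/-! Everything rests on a dichotomy (`tendsto_survival_or_expReturn`): under any policy either the
probability of not having reached the goal tends to 0, or each step costs at least a fixed positive
amount and the return tends to `-∞`. Hence only the existence of a proper policy matters in (P), and
this does not involve the rewards. A solution of the Bellman optimality equation that is zero on
goals must then be `Q^*` (`optActionValue_eq_of_bellmanResidual`): returns telescope to `Q` minus a
nonnegative gap and a boundary term that vanishes with survival, and a greedy policy has zero gap.
For the first claim, pay the Bellman residual of `Q` as a deterministic reward. For the second,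
value iteration from 0 decreases and is bounded below by a multiple of the Lyapunov function of a
proper policy, so its limit solves the Bellman equation (`exists_bellmanOp_fixed`). -/

/-- The expectation of a real function under a probability mass function on a finite type. -/
def PMF.expect {α : Type*} [Fintype α] (p : PMF α) (f : α → ℝ) : ℝ :=
  ∑ x, (p x).toReal * f x

/-! ### Expectations on finite types. -/

namespace PMF

variable {α β : Type*} [Fintype α] [Fintype β]

theorem sum_toReal (p : PMF α) : ∑ x, (p x).toReal = 1 := by
  rw [← ENNReal.toReal_sum fun x _ => p.apply_ne_top x, ← tsum_fintype (L := .unconditional α),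
    p.tsum_coe, ENNReal.toReal_one]

theorem expect_const (p : PMF α) (k : ℝ) : p.expect (fun _ => k) = k := by
  rw [expect, ← Finset.sum_mul, p.sum_toReal, one_mul]

theorem expect_mono (p : PMF α) {f g : α → ℝ} (h : ∀ x, f x ≤ g x) : p.expect f ≤ p.expect g :=
  Finset.sum_le_sum fun x _ => mul_le_mul_of_nonneg_left (h x) ENNReal.toReal_nonneg

theorem expect_sub (p : PMF α) (f g : α → ℝ) :
    p.expect (fun x => f x - g x) = p.expect f - p.expect g := by
  simp only [expect, mul_sub, Finset.sum_sub_distrib]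

theorem expect_const_mul (p : PMF α) (k : ℝ) (f : α → ℝ) :
    p.expect (fun x => k * f x) = k * p.expect f := by
  simp only [expect, Finset.mul_sum, mul_left_comm]

theorem expect_sum {ι : Type*} (p : PMF α) (s : Finset ι) (f : ι → α → ℝ) :
    p.expect (fun x => ∑ i ∈ s, f i x) = ∑ i ∈ s, p.expect (f i) := by
  simp only [expect, Finset.mul_sum]
  exact Finset.sum_comm

theorem expect_pure (a : α) (f : α → ℝ) : (PMF.pure a).expect f = f a := by
  classical
  rw [expect, Finset.sum_eq_single a]
  · simp
  · intro b _ hb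
    simp [PMF.pure_apply, hb]
  · simp

theorem expect_bind (p : PMF α) (k : α → PMF β) (f : β → ℝ) :
    (p.bind k).expect f = p.expect fun a => (k a).expect f := by
  have h : ∀ b, ((p.bind k) b).toReal = ∑ a, (p a).toReal * (k a b).toReal := by
    intro b
    rw [PMF.bind_apply, tsum_fintype, ENNReal.toReal_sum]
    · simp only [ENNReal.toReal_mul]
    · exact fun a _ => ENNReal.mul_ne_top (p.apply_ne_top a) ((k a).apply_ne_top b)
  simp only [expect, h, Finset.sum_mul, Finset.mul_sum]
  rw [Finset.sum_comm]
  simp only [mul_assoc]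

theorem expect_map (p : PMF α) (g : α → β) (f : β → ℝ) :
    (p.map g).expect f = p.expect fun a => f (g a) := by
  rw [← PMF.bind_pure_comp, expect_bind]
  simp only [Function.comp_apply, expect_pure]

theorem toReal_toOuterMeasure (p : PMF α) (s : Set α) :
    (p.toOuterMeasure s).toReal = p.expect (s.indicator 1) := by
  rw [PMF.toOuterMeasure_apply, tsum_fintype, ENNReal.toReal_sum]
  · refine Finset.sum_congr rfl fun x _ => ?_
    by_cases hx : x ∈ s <;> simp [hx]
  · intro x _
    by_cases hx : x ∈ s <;> simp [hx, p.apply_ne_top x]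

theorem tendsto_expect (p : PMF α) {f : ℕ → α → ℝ} {g : α → ℝ}
    (h : ∀ x, Tendsto (fun n => f n x) atTop (𝓝 (g x))) :
    Tendsto (fun n => p.expect (f n)) atTop (𝓝 (p.expect g)) :=
  tendsto_finsetSum _ fun x _ => (h x).const_mul _

end PMF

namespace GoalMDP

variable {S : Type*} {A : S → Type*}

/-- The indicator of the non-goal states. -/
def live (M : GoalMDP S A) : S → ℝ := M.goalᶜ.indicator 1

theorem live_of_mem (M : GoalMDP S A) {s : S} (hs : s ∈ M.goal) : M.live s = 0 := by
  simp [live, hs]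

theorem live_of_notMem (M : GoalMDP S A) {s : S} (hs : s ∉ M.goal) : M.live s = 1 := by
  simp [live, hs]

theorem live_nonneg (M : GoalMDP S A) (s : S) : 0 ≤ M.live s :=
  Set.indicator_nonneg (fun _ _ => zero_le_one) s

theorem live_le_one (M : GoalMDP S A) (s : S) : M.live s ≤ 1 :=
  Set.indicator_le_self' (fun _ _ => zero_le_one) s

theorem RewardDist.mean_of_mem {M : GoalMDP S A} (R : M.RewardDist) {s : S} (hs : s ∈ M.goal)
    (a : A s) : R.mean s a = 0 := by
  rw [RewardDist.mean, R.goal_zero s hs a, integral_dirac]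

theorem RewardDist.NonGoalBelow.mean_le {M : GoalMDP S A} {R : M.RewardDist} {c : ℝ}
    (hR : R.NonGoalBelow c) (s : S) (a : A s) : R.mean s a ≤ c * M.live s := by
  by_cases hs : s ∈ M.goal
  · rw [R.mean_of_mem hs, M.live_of_mem hs, mul_zero]
  · rw [M.live_of_notMem hs, mul_one]
    exact (hR s hs a).le

section maxValue

variable [∀ s, Fintype (A s)] [∀ s, Nonempty (A s)]

/-- The state value `max_a Q(s, a)` of a function on state-action pairs. -/
def maxValue (Q : (s : S) → A s → ℝ) (s : S) : ℝ :=
  Finset.univ.sup' Finset.univ_nonempty (Q s)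

theorem le_maxValue (Q : (s : S) → A s → ℝ) (s : S) (a : A s) : Q s a ≤ maxValue Q s :=
  Finset.le_sup' (Q s) (Finset.mem_univ a)

theorem maxValue_le {Q : (s : S) → A s → ℝ} {s : S} {k : ℝ} (h : ∀ a, Q s a ≤ k) :
    maxValue Q s ≤ k :=
  Finset.sup'_le _ _ fun a _ => h a

theorem exists_maxValue_eq (Q : (s : S) → A s → ℝ) (s : S) : ∃ a, Q s a = maxValue Q s := by
  obtain ⟨a, -, ha⟩ := Finset.exists_mem_eq_sup' Finset.univ_nonempty (Q s)
  exact ⟨a, ha.symm⟩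

theorem maxValue_eq_zero {Q : (s : S) → A s → ℝ} {s : S} (h : ∀ a, Q s a = 0) :
    maxValue Q s = 0 := by
  obtain ⟨a, ha⟩ := exists_maxValue_eq Q s
  rw [← ha, h a]

end maxValue

variable [Fintype S]

theorem expect_trans_live_le (M : GoalMDP S A) (s : S) (a : A s) :
    (M.trans s a).expect M.live ≤ M.live s := by
  by_cases hs : s ∈ M.goal
  · rw [M.absorbing s hs a, PMF.expect_pure]
  · rw [M.live_of_notMem hs]
    exact ((M.trans s a).expect_mono M.live_le_one).trans_eq ((M.trans s a).expect_const 1)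

variable [∀ s, Fintype (A s)]

theorem expect_pairAt (π : Policy A) (s : S) (f : (s : S) × A s → ℝ) :
    (pairAt π s).expect f = (π s).expect fun a => f ⟨s, a⟩ :=
  PMF.expect_map _ _ _

theorem expect_pairLaw_succ (M : GoalMDP S A) (π : Policy A) (ν : PMF ((s : S) × A s)) (t : ℕ)
    (f : (s : S) × A s → ℝ) :
    (M.pairLaw π ν (t + 1)).expect f = (M.pairLaw π ν t).expect fun x =>
      (M.trans x.1 x.2).expect fun s => (π s).expect fun a => f ⟨s, a⟩ := by
  simp only [pairLaw, PMF.expect_bind, expect_pairAt]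

theorem expect_pairLaw_succ_state (M : GoalMDP S A) (π : Policy A) (ν : PMF ((s : S) × A s))
    (t : ℕ) (f : S → ℝ) :
    (M.pairLaw π ν (t + 1)).expect (fun x => f x.1) =
      (M.pairLaw π ν t).expect fun x => (M.trans x.1 x.2).expect f := by
  simp only [expect_pairLaw_succ, PMF.expect_const]

/-! ### Survival probabilities and the dichotomy. -/

/-- The probability that no goal state has been reached at time `t`. -/
def survival (M : GoalMDP S A) (π : Policy A) (ν : PMF ((s : S) × A s)) (t : ℕ) : ℝ :=
  (M.pairLaw π ν t).expect fun x => M.live x.1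

theorem survival_nonneg (M : GoalMDP S A) (π : Policy A) (ν : PMF ((s : S) × A s)) (t : ℕ) :
    0 ≤ M.survival π ν t :=
  ((M.pairLaw π ν t).expect_const 0).ge.trans
    ((M.pairLaw π ν t).expect_mono fun x => M.live_nonneg x.1)

theorem survival_antitone (M : GoalMDP S A) (π : Policy A) (ν : PMF ((s : S) × A s)) :
    Antitone (M.survival π ν) := by
  refine antitone_nat_of_succ_le fun t => ?_
  rw [survival, expect_pairLaw_succ_state]
  exact PMF.expect_mono _ fun x => M.expect_trans_live_le x.1 x.2

theorem isProper_iff (M : GoalMDP S A) (π : Policy A) :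
    M.IsProper π ↔ ∀ s, Tendsto (M.survival π (pairAt π s)) atTop (𝓝 0) := by
  refine forall_congr' fun s => ?_
  have h : M.survival π (pairAt π s) = fun t =>
      ((M.pairLaw π (pairAt π s) t).toOuterMeasure {x | x.1 ∉ M.goal}).toReal := by
    funext t
    rw [PMF.toReal_toOuterMeasure]
    rfl
  rw [h, ← ENNReal.toReal_zero, ENNReal.tendsto_toReal_iff _ ENNReal.zero_ne_top]
  intro t
  refine ne_top_of_le_ne_top ENNReal.one_ne_top ?_
  rw [← (PMF.toOuterMeasure_apply_eq_one_iff (M.pairLaw π (pairAt π s) t)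
    (s := Set.univ)).2 (Set.subset_univ _)]
  exact measure_mono (Set.subset_univ _)

theorem expReturn_eq (M : GoalMDP S A) (R : M.RewardDist) (π : Policy A)
    (ν : PMF ((s : S) × A s)) (τ : ℕ) :
    M.expReturn R π ν τ =
      ∑ t ∈ Finset.range (τ + 1), (M.pairLaw π ν t).expect fun x => R.mean x.1 x.2 := rfl

/-- Survival decreases to some `δ ≥ 0`. If `δ > 0`, every expected reward is at most `c * δ < 0`,
because means are at most `c` off the goal and zero on it; the returns then fall at least linearly.
-/
theorem tendsto_survival_or_expReturn (M : GoalMDP S A) {R : M.RewardDist} {c : ℝ} (hc : c < 0)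
    (hR : R.NonGoalBelow c) (π : Policy A) (ν : PMF ((s : S) × A s)) :
    Tendsto (M.survival π ν) atTop (𝓝 0) ∨ Tendsto (M.expReturn R π ν) atTop atBot := by
  have hbdd : BddBelow (Set.range (M.survival π ν)) :=
    ⟨0, Set.forall_mem_range.2 (M.survival_nonneg π ν)⟩
  have hlim := tendsto_atTop_ciInf (M.survival_antitone π ν) hbdd
  have hle : ∀ t, ⨅ i, M.survival π ν i ≤ M.survival π ν t := fun t => ciInf_le hbdd t
  have hnonneg : 0 ≤ ⨅ i, M.survival π ν i := le_ciInf (M.survival_nonneg π ν)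
  generalize (⨅ i, M.survival π ν i) = δ at *
  rcases hnonneg.eq_or_lt with rfl | hδ
  · exact Or.inl hlim
  suffices h : ∀ τ : ℕ, M.expReturn R π ν τ ≤ ((τ : ℝ) + 1) * (c * δ) by
    refine Or.inr (tendsto_atBot_mono h ?_)
    exact (tendsto_atTop_add_const_right _ _ tendsto_natCast_atTop_atTop).atTop_mul_const_of_neg
      (mul_neg_of_neg_of_pos hc hδ)
  intro τ
  have hterm : ∀ t, ((M.pairLaw π ν t).expect fun x => R.mean x.1 x.2) ≤ c * δ := fun t =>
    (((M.pairLaw π ν t).expect_mono fun x => hR.mean_le x.1 x.2).trans_eq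
      (PMF.expect_const_mul _ _ _)).trans (mul_le_mul_of_nonpos_left (hle t) hc.le)
  rw [expReturn_eq]
  refine (Finset.sum_le_sum fun t _ => hterm t).trans_eq ?_
  simp

/-- If all expected rewards at non-goal pairs are below a negative constant, then the condition on
a reward distribution reduces to the existence of a proper deterministic policy. -/
theorem properCondition_of_nonGoalBelow (M : GoalMDP S A) {R : M.RewardDist} {c : ℝ} (hc : c < 0)
    (hR : R.NonGoalBelow c) (h : ∃ μ : DetPolicy A, M.IsProper μ.toPolicy) :
    M.ProperCondition R := by
  refine ⟨h, fun μ hμ => ?_⟩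
  rw [isProper_iff, not_forall] at hμ
  obtain ⟨s, hs⟩ := hμ
  exact ⟨s, (M.tendsto_survival_or_expReturn hc hR _ _).resolve_left hs⟩

/-- The survival probabilities of a deterministic policy satisfy the backward recursion. -/
theorem survival_toPolicy_succ (M : GoalMDP S A) (μ : DetPolicy A) (s : S) (t : ℕ) :
    M.survival μ.toPolicy (pairAt μ.toPolicy s) (t + 1) =
      (M.trans s (μ s)).expect fun s' => M.survival μ.toPolicy (pairAt μ.toPolicy s') t := by
  -- `pairLaw` appends steps at the end, whereas the recursion conditions on the first one.
  -- Quantifying over `f` lets the induction absorb the last step into `f`.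
  have key : ∀ (t : ℕ) (s : S) (f : (s : S) × A s → ℝ),
      (M.pairLaw μ.toPolicy (pairAt μ.toPolicy s) (t + 1)).expect f =
        (M.trans s (μ s)).expect fun s' =>
          (M.pairLaw μ.toPolicy (pairAt μ.toPolicy s') t).expect f := by
    intro t
    induction t with
    | zero =>
      intro s f
      simp only [pairLaw, PMF.expect_bind, expect_pairAt, DetPolicy.toPolicy, PMF.expect_pure]
    | succ t ih =>
      intro s f
      rw [expect_pairLaw_succ, ih]
      simp only [expect_pairLaw_succ]
  exact key t s _

theorem survival_toPolicy_zero (M : GoalMDP S A) (μ : DetPolicy A) (s : S) :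
    M.survival μ.toPolicy (pairAt μ.toPolicy s) 0 = M.live s := by
  simp only [survival, pairLaw, expect_pairAt, PMF.expect_const]

/-- A proper deterministic policy admits a Lyapunov function. -/
theorem exists_lyapunov (M : GoalMDP S A) {μ : DetPolicy A} (hμ : M.IsProper μ.toPolicy) :
    ∃ g : S → ℝ, (∀ s, 0 ≤ g s) ∧ ∀ s, M.live s + (M.trans s (μ s)).expect g ≤ g s := by
  rw [isProper_iff] at hμ
  have hev : ∀ᶠ t in atTop, ∀ s, M.survival μ.toPolicy (pairAt μ.toPolicy s) t < 1 / 2 :=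
    eventually_all.2 fun s => (hμ s).eventually_lt_const (by norm_num)
  obtain ⟨N, hN⟩ := hev.exists
  -- Survival from a goal state is 0, so the uniform bound sharpens to one proportional to `live`.
  have hhalf : ∀ s, M.survival μ.toPolicy (pairAt μ.toPolicy s) N ≤ M.live s / 2 := by
    intro s
    by_cases hs : s ∈ M.goal
    · have h := M.survival_antitone μ.toPolicy (pairAt μ.toPolicy s) (Nat.zero_le N)
      rw [survival_toPolicy_zero, M.live_of_mem hs] at h
      rw [M.live_of_mem hs, zero_div]
      exact h
    · rw [M.live_of_notMem hs]
      exact (hN s).le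
  -- Shifting time by one removes the term `live s` from the sum and adds the survival at `N`, at
  -- most `live s / 2`. The net drop is at least `live s / 2`, whence the factor 2.
  refine ⟨fun s => 2 * ∑ t ∈ Finset.range N, M.survival μ.toPolicy (pairAt μ.toPolicy s) t,
    fun s => mul_nonneg zero_le_two (Finset.sum_nonneg fun t _ => M.survival_nonneg _ _ t),
    fun s => ?_⟩
  rw [PMF.expect_const_mul, PMF.expect_sum]
  simp only [← survival_toPolicy_succ]
  have h1 := Finset.sum_range_succ (M.survival μ.toPolicy (pairAt μ.toPolicy s)) N
  rw [Finset.sum_range_succ', survival_toPolicy_zero] at h1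
  linarith [hhalf s]

variable [∀ s, Nonempty (A s)]

/-! ### Telescoping and verification of Bellman solutions. -/

theorem bellmanResidual_eq (M : GoalMDP S A) (Q : (s : S) → A s → ℝ) (s : S) (a : A s) :
    M.bellmanResidual Q s a = Q s a - (M.trans s a).expect (maxValue Q) := by
  simp only [bellmanResidual, PMF.expect, maxValue, mul_comm]

theorem bellmanResidual_of_mem (M : GoalMDP S A) {Q : (s : S) → A s → ℝ} {s : S}
    (hs : s ∈ M.goal) (hQ : ∀ a, Q s a = 0) (a : A s) : M.bellmanResidual Q s a = 0 := by
  rw [bellmanResidual_eq, M.absorbing s hs a, PMF.expect_pure, hQ, maxValue_eq_zero hQ, sub_zero]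

/-- The gap `∑_{0 < t ≤ τ} E[max_a Q(S_t, a) - Q(S_t, A_t)]` is the defect in the telescoping
identity for the returns of a policy. -/
theorem expReturn_add_gap (M : GoalMDP S A) {R : M.RewardDist} {Q : (s : S) → A s → ℝ}
    (hQR : ∀ s a, M.bellmanResidual Q s a = R.mean s a) (π : Policy A)
    (ν : PMF ((s : S) × A s)) (τ : ℕ) :
    M.expReturn R π ν τ + ∑ t ∈ Finset.range τ, (M.pairLaw π ν (t + 1)).expect
        (fun x => maxValue Q x.1 - Q x.1 x.2) =
      ν.expect (fun x => Q x.1 x.2) -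
        (M.pairLaw π ν (τ + 1)).expect (fun x => maxValue Q x.1) := by
  have hterm : ∀ t, ((M.pairLaw π ν t).expect fun x => R.mean x.1 x.2) =
      (M.pairLaw π ν t).expect (fun x => Q x.1 x.2) -
        (M.pairLaw π ν (t + 1)).expect (fun x => maxValue Q x.1) := by
    intro t
    simp only [← hQR, bellmanResidual_eq, PMF.expect_sub, expect_pairLaw_succ_state]
  simp only [expReturn_eq, hterm]
  induction τ with
  | zero => simp [pairLaw]
  | succ τ ih =>
    simp only [PMF.expect_sub, Finset.sum_range_succ] at ih ⊢
    linarith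

/-- The maximum vanishes on goals and takes finitely many values, so it is dominated by a multiple
of `live`, uniformly in policy, initial law and time. -/
theorem abs_expect_maxValue_le (M : GoalMDP S A) {Q : (s : S) → A s → ℝ}
    (hQ : ∀ s ∈ M.goal, ∀ a, Q s a = 0) : ∃ B : ℝ, ∀ (π : Policy A) (ν : PMF ((s : S) × A s))
      (t : ℕ), |(M.pairLaw π ν t).expect fun x => maxValue Q x.1| ≤ B * M.survival π ν t := by
  refine ⟨∑ s, |maxValue Q s|, fun π ν t => ?_⟩
  have hb : ∀ s, |maxValue Q s| ≤ (∑ s, |maxValue Q s|) * M.live s := by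
    intro s
    by_cases hs : s ∈ M.goal
    · rw [maxValue_eq_zero (hQ s hs), M.live_of_mem hs, abs_zero, mul_zero]
    · rw [M.live_of_notMem hs, mul_one]
      exact Finset.single_le_sum (f := fun s => |maxValue Q s|) (fun _ _ => abs_nonneg _)
        (Finset.mem_univ s)
  rw [survival, ← PMF.expect_const_mul, abs_le]
  constructor
  · rw [← neg_one_mul, ← PMF.expect_const_mul]
    refine PMF.expect_mono _ fun x => ?_
    rw [neg_one_mul]
    exact (abs_le.1 (hb x.1)).1
  · exact PMF.expect_mono _ fun x => (abs_le.1 (hb x.1)).2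

/-- A solution of the Bellman optimality equation that vanishes at goal states is the optimal
action-value function, provided that the expected rewards at non-goal pairs are below a negative
constant. -/
theorem optActionValue_eq_of_bellmanResidual (M : GoalMDP S A) {R : M.RewardDist} {c : ℝ}
    (hc : c < 0) (hR : R.NonGoalBelow c) {Q : (s : S) → A s → ℝ}
    (hQ : ∀ s ∈ M.goal, ∀ a, Q s a = 0)
    (hQR : ∀ s a, M.bellmanResidual Q s a = R.mean s a) (s : S) (a : A s) :
    M.optActionValue R s a = (Q s a : EReal) := by
  obtain ⟨B, hB⟩ := M.abs_expect_maxValue_le hQ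
  set ν : PMF ((s : S) × A s) := PMF.pure ⟨s, a⟩ with hν
  have hzero : ∀ π : Policy A, Tendsto (M.survival π ν) atTop (𝓝 0) →
      Tendsto (fun τ => Q s a - (M.pairLaw π ν (τ + 1)).expect fun x => maxValue Q x.1) atTop
        (𝓝 (Q s a)) := by
    intro π hπ
    have h : Tendsto (fun t => (M.pairLaw π ν t).expect fun x => maxValue Q x.1) atTop (𝓝 0) :=
      squeeze_zero_norm (hB π ν) (by simpa using hπ.const_mul B)
    simpa using ((tendsto_add_atTop_iff_nat 1).2 h).const_sub (Q s a)
  have hid := fun π τ => M.expReturn_add_gap hQR π ν τ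
  simp only [hν, PMF.expect_pure] at hid
  rw [← hν] at hid
  refine le_antisymm (iSup_le fun π => ?_) ?_
  -- When survival vanishes, dropping the nonnegative gap bounds the return by a sequence tending to
  -- `Q s a`; otherwise the action value is `-∞`.
  · rcases M.tendsto_survival_or_expReturn hc hR π ν with hπ | hπ
    · refine le_trans (liminf_le_liminf (Eventually.of_forall fun τ => ?_))
        ((continuous_coe_real_ereal.tendsto _).comp (hzero π hπ)).liminf_eq.le
      refine EReal.coe_le_coe_iff.2 ?_
      refine le_of_le_of_eq ?_ (hid π τ)
      refine le_add_of_nonneg_right (Finset.sum_nonneg fun t _ => ?_)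
      refine (PMF.expect_const _ 0).ge.trans (PMF.expect_mono _ fun x => ?_)
      exact sub_nonneg.2 (le_maxValue Q x.1 x.2)
    · exact (EReal.tendsto_coe_nhds_bot_iff.2 hπ).liminf_eq.le.trans bot_le
  -- The supremum is attained by a policy greedy for `Q`, whose gap is zero.
  · choose μ hμ using exists_maxValue_eq Q
    refine le_trans ?_ (le_iSup _ (DetPolicy.toPolicy μ))
    have hret : ∀ τ, M.expReturn R (DetPolicy.toPolicy μ) ν τ =
        Q s a - (M.pairLaw (DetPolicy.toPolicy μ) ν (τ + 1)).expect fun x => maxValue Q x.1 := by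
      intro τ
      rw [← hid, left_eq_add]
      refine Finset.sum_eq_zero fun t _ => ?_
      simp only [expect_pairLaw_succ, DetPolicy.toPolicy, PMF.expect_pure, hμ, sub_self,
        PMF.expect_const]
    -- Greedy returns equal `Q s a` up to a bounded boundary term, so they cannot tend to `-∞`. The
    -- sign of `B` is not recorded, hence `|B|`.
    have hlim : Tendsto (M.survival (DetPolicy.toPolicy μ) ν) atTop (𝓝 0) := by
      refine (M.tendsto_survival_or_expReturn hc hR _ ν).resolve_right fun h => ?_
      obtain ⟨τ, hτ⟩ := (h.eventually_lt_atBot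
        (Q s a - |B| * M.survival (DetPolicy.toPolicy μ) ν 0)).exists
      rw [hret] at hτ
      have h1 := (abs_le.1 (hB (DetPolicy.toPolicy μ) ν (τ + 1))).2
      have h2 := mul_le_mul_of_nonneg_right (le_abs_self B)
        (M.survival_nonneg (DetPolicy.toPolicy μ) ν (τ + 1))
      have h3 := mul_le_mul_of_nonneg_left
        (M.survival_antitone (DetPolicy.toPolicy μ) ν (Nat.zero_le (τ + 1))) (abs_nonneg B)
      linarith
    refine Eq.ge ?_
    simp only [actionValue, ← hν, hret]
    exact ((continuous_coe_real_ereal.tendsto _).comp (hzero _ hlim)).liminf_eq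

/-- The reward distribution that pays the Bellman residual of `Q` deterministically. -/
def residualReward (M : GoalMDP S A) (Q : (s : S) → A s → ℝ)
    (hQ : ∀ s ∈ M.goal, ∀ a, Q s a = 0) : M.RewardDist where
  law s a := Measure.dirac (M.bellmanResidual Q s a)
  isProb _ _ := inferInstance
  integrable s a := integrable_dirac (by simp)
  goal_zero s hs a := by rw [M.bellmanResidual_of_mem hs (hQ s hs)]

theorem mean_residualReward (M : GoalMDP S A) (Q : (s : S) → A s → ℝ)
    (hQ : ∀ s ∈ M.goal, ∀ a, Q s a = 0) (s : S) (a : A s) :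
    (M.residualReward Q hQ).mean s a = M.bellmanResidual Q s a :=
  integral_dirac _ _

/-! ### Value iteration. -/

/-- The Bellman optimality operator on state values. -/
def bellmanOp (M : GoalMDP S A) (r : (s : S) → A s → ℝ) (V : S → ℝ) : S → ℝ :=
  maxValue fun s a => r s a + (M.trans s a).expect V

theorem bellmanOp_mono (M : GoalMDP S A) (r : (s : S) → A s → ℝ) : Monotone (M.bellmanOp r) :=
  fun _ _ h s => maxValue_le fun a => (add_le_add_right (PMF.expect_mono _ h) _).trans
    (le_maxValue (fun s a => r s a + (M.trans s a).expect _) s a)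

/-- Value iteration from `0` converges to a solution of the Bellman optimality equation. -/
theorem exists_bellmanOp_fixed (M : GoalMDP S A) {r : (s : S) → A s → ℝ}
    (hr : ∀ s a, r s a ≤ 0) (hgoal : ∀ s ∈ M.goal, ∀ a, r s a = 0)
    (hμ : ∃ μ : DetPolicy A, M.IsProper μ.toPolicy) :
    ∃ V : S → ℝ, M.bellmanOp r V = V ∧ ∀ s ∈ M.goal, V s = 0 := by
  obtain ⟨μ, hμ⟩ := hμ
  obtain ⟨g, hg, hlyap⟩ := M.exists_lyapunov hμ
  set K : ℝ := ∑ s, |r s (μ s)| with hK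
  have hK0 : 0 ≤ K := Finset.sum_nonneg fun _ _ => abs_nonneg _
  have hKr : ∀ s, -(K * M.live s) ≤ r s (μ s) := by
    intro s
    by_cases hs : s ∈ M.goal
    · rw [hgoal s hs, M.live_of_mem hs, mul_zero, neg_zero]
    · rw [M.live_of_notMem hs, mul_one]
      exact (abs_le.1 (Finset.single_le_sum (f := fun s => |r s (μ s)|)
        (fun _ _ => abs_nonneg _) (Finset.mem_univ s))).1
  -- `-K * g` is a subsolution: the action `μ s` alone achieves it, by the Lyapunov inequality and
  -- `r s (μ s) ≥ -K * live s`. Monotonicity then keeps all iterates above it.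
  have hsub : (fun s => -K * g s) ≤ M.bellmanOp r fun s => -K * g s := by
    intro s
    refine le_trans ?_ (le_maxValue (fun s a => r s a + (M.trans s a).expect _) s (μ s))
    have h := mul_le_mul_of_nonneg_left (hlyap s) hK0
    rw [PMF.expect_const_mul]
    linarith [hKr s]
  have hzero : M.bellmanOp r 0 ≤ 0 := by
    refine fun s => maxValue_le fun a => ?_
    have h : (M.trans s a).expect 0 = 0 := PMF.expect_const _ 0
    simpa [h] using hr s a
  have hanti : Antitone fun n => (M.bellmanOp r)^[n] 0 :=
    (M.bellmanOp_mono r).antitone_iterate_of_map_le hzero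
  have hbelow : ∀ n, (fun s => -K * g s) ≤ (M.bellmanOp r)^[n] 0 := by
    intro n
    induction n with
    | zero => exact fun s => mul_nonpos_of_nonpos_of_nonneg (neg_nonpos.2 hK0) (hg s)
    | succ n ih =>
      rw [Function.iterate_succ_apply']
      exact hsub.trans (M.bellmanOp_mono r ih)
  have hlim : ∀ s, Tendsto (fun n => (M.bellmanOp r)^[n] 0 s) atTop
      (𝓝 (⨅ n, (M.bellmanOp r)^[n] 0 s)) := fun s =>
    tendsto_atTop_ciInf (fun _ _ h => hanti h s)
      ⟨-K * g s, Set.forall_mem_range.2 fun n => hbelow n s⟩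
  refine ⟨fun s => ⨅ n, (M.bellmanOp r)^[n] 0 s, ?_, fun s hs => ?_⟩
  · funext s
    refine tendsto_nhds_unique ?_ ((tendsto_add_atTop_iff_nat 1).2 (hlim s))
    -- Finite maxima and finite expectations are continuous, so the pointwise limit passes through
    -- the operator.
    simp only [Function.iterate_succ_apply']
    refine Filter.Tendsto.finset_sup'_nhds_apply Finset.univ_nonempty fun a _ => ?_
    exact (PMF.tendsto_expect _ hlim).const_add _
  · have h : ∀ n, (M.bellmanOp r)^[n] 0 s = 0 := by
      intro n
      induction n with
      | zero => rfl
      | succ n ih =>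
        rw [Function.iterate_succ_apply']
        refine maxValue_eq_zero fun a => ?_
        rw [hgoal s hs, M.absorbing s hs, PMF.expect_pure, ih, add_zero]
    simp only [h, ciInf_const]

end GoalMDP

end

theorem mainTheorem5 {S : Type*} {A : S → Type*} [Fintype S] [∀ s, Fintype (A s)]
    [∀ s, Nonempty (A s)] (M : GoalMDP S A)
    (hM : ∃ R₀ : M.RewardDist, M.ProperCondition R₀) (c : ℝ) (hc : c < 0) :
    (∀ Q ∈ M.residualSet c, ∃ R : M.RewardDist, R.NonGoalBelow c ∧ M.ProperCondition R ∧
      ∀ (s : S) (a : A s), M.optActionValue R s a = (Q s a : EReal)) ∧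
    (∀ R : M.RewardDist, R.NonGoalBelow c → M.ProperCondition R →
      ∃ Q ∈ M.residualSet c, ∀ (s : S) (a : A s), M.optActionValue R s a = (Q s a : EReal)) := by
  refine ⟨fun Q hQ => ?_, fun R hR hP => ?_⟩
  -- Properness does not depend on rewards, so the proper policy found under `R₀` serves for the
  -- residual reward.
  · obtain ⟨R₀, hR₀, -⟩ := hM
    have hmean := M.mean_residualReward Q hQ.2
    have hbelow : (M.residualReward Q hQ.2).NonGoalBelow c := fun s hs a =>
      (hmean s a).trans_lt (hQ.1 s hs a)
    exact ⟨M.residualReward Q hQ.2, hbelow, M.properCondition_of_nonGoalBelow hc hbelow hR₀,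
      M.optActionValue_eq_of_bellmanResidual hc hbelow hQ.2 fun s a => (hmean s a).symm⟩
  · obtain ⟨V, hV, hV0⟩ := M.exists_bellmanOp_fixed
      (fun s a => (hR.mean_le s a).trans (mul_nonpos_of_nonpos_of_nonneg hc.le (M.live_nonneg s)))
      (fun s hs a => R.mean_of_mem hs a) hP.1
    have hQ : ∀ s ∈ M.goal, ∀ a, R.mean s a + (M.trans s a).expect V = 0 := by
      intro s hs a
      rw [R.mean_of_mem hs, M.absorbing s hs, PMF.expect_pure, hV0 s hs, add_zero]
    have hres : ∀ s a, M.bellmanResidual (fun s a => R.mean s a + (M.trans s a).expect V) s a =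
        R.mean s a := by
      intro s a
      rw [GoalMDP.bellmanResidual_eq]
      -- The state maximum of this `Q` is by definition the Bellman operator applied to `V`, so the
      -- fixed-point equation cancels the two expectations.
      change _ - (M.trans s a).expect (M.bellmanOp R.mean V) = _
      rw [hV, add_sub_cancel_right]
    exact ⟨_, ⟨fun s hs a => (hres s a).trans_lt (hR s hs a), hQ⟩,
      M.optActionValue_eq_of_bellmanResidual hc hR hQ hres⟩
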